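/- Let $M$ be a smooth Hausdorff finite-dimensional manifold and let $\boldsymbol\eta\in\Omega^1(M,\mathbb R^k)$ be a $k$-contact form, i.e. a smooth $\mathbb R^k$-valued one-form such that $\ker\boldsymbol\eta$ is a non-zero regular distribution of corank $k$, $\ker \mathrm d\boldsymbol\eta$ is a regular distribution of rank $k$, and $\ker\boldsymbol\eta\cap\ker \mathrm d\boldsymbol\eta=0$. Let $R_1,\dots,R_k$ be its Reeb vector fields, determined by $\iota_{R_\alpha}\eta^\beta=\delta_\alpha^\beta$ and $\iota_{R_\alpha}\mathrm d\eta^\beta=0$. An $\boldsymbol\eta$-Hamiltonian vector field is a smooth vector field $X$ such that $[X,Y]$ takes values in $\ker\boldsymbol\eta$ for each smooth vector field $Y$ taking values in $\ker\boldsymbol\eta$; its $\boldsymbol\eta$-Hamiltonian $k$-function is $\boldsymbol f=-\iota_X\boldsymbol\eta$, which determines $X=:X_{\boldsymbol f}$. Put $\{\boldsymbol f,\boldsymbol g\}_{\boldsymbol\eta}=\boldsymbol\eta([X_{\boldsymbol f},X_{\boldsymbol g}])$ for $\boldsymbol\eta$-Hamiltonian $k$-functions $\boldsymbol f,\boldsymbol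 g$. Let $\theta\in\mathbb R^{k*}$ and $\omega=\langle \mathrm d\boldsymbol\eta,\theta\rangle$. (1) The form $\omega$ is presymplectic, i.e. a smooth closed two-form (its rank need not be constant). A Hamiltonian function of $\omega$ is a smooth function $f$ on $M$ such that $\iota_Y\omega=\mathrm df$ for some smooth vector field $Y$. An admissible function of $\omega$ is a smooth function $f$ such that $\mathrm df_x$ lies in the image of $v\mapsto\iota_v\omega_x$ for each $x\in M$. On admissible functions, $\{f,g\}_\omega(x)=\omega_x(v,w)$ for any $v,w\in T_xM$ with $\iota_v\omega_x=\mathrm df_x$ and $\iota_w\omega_x=\mathrm dg_x$. Let $\mathfrak W=\langle\boldsymbol h_1,\dots,\boldsymbol h_r\rangle$ be a finite-dimensional real vector space of $\boldsymbol\eta$-Hamiltonian $k$-functions that is closed under $\{\cdot,\cdot\}_{\boldsymbol\eta}$ and whose elements satisfy $R_\alpha\boldsymbol f=0$ for $\alpha=1,\dots,k$, and let $\mathfrak W^\theta=\langle\langle\boldsymbol h_1,\theta\rangle,\dots,\langle\boldsymbol h_r,\theta\rangle\rangle$. (2) The space $\mathfrak W$ is a Lie algebra under $\{\cdot,\cdot\}_{\boldsymbol\eta}$,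 the space $\mathfrak W^\theta$ consists of Hamiltonian functions of $\omega$ and is a Lie algebra under $\{\cdot,\cdot\}_\omega$, and $\boldsymbol f\mapsto\langle\boldsymbol f,\theta\rangle$ is a surjective Lie algebra morphism $\mathfrak W\to\mathfrak W^\theta$. (3) If $C$ is an admissible function of $\omega$ with $\{C,g\}_\omega=0$ for all $g\in\mathfrak W^\theta$, then $C$ is a constant of motion of each Lie system $X$ with $\boldsymbol\eta$-Lie–Hamilton algebra $\mathfrak W$, i.e. of each $t$-dependent vector field $X$ such that, for each $t\in\mathbb R$, $X_t$ is the $\boldsymbol\eta$-Hamiltonian vector field of some element of $\mathfrak W$. That is, $X_tC=0$ for all $t\in\mathbb R$, and $C$ is constant along each solution of $\mathrm dx/\mathrm dt=X(t,x)$ defined on an interval. -/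

import Mathlib

open scoped Manifold ContDiff

noncomputable section

namespace KContact

section Forms

variable {E : Type*} [NormedAddCommGroup E] [NormedSpace ℝ E]
variable {M : Type*} [TopologicalSpace M] [ChartedSpace E M]
variable {F : Type*} [NormedAddCommGroup F] [NormedSpace ℝ F]

variable (E M) in
/-- (Not necessarily continuous) vector fields on the manifold `M` modelled on `E`. -/
abbrev VField := (x : M) → TangentSpace 𝓘(ℝ, E) x

variable (E M F) in
/-- (Not necessarily continuous) `F`-valued differential `n`-forms on `M`. -/
abbrev DForm (n : ℕ) := (x : M) → (TangentSpace 𝓘(ℝ, E) x) [⋀^Fin n]→L[ℝ] F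

/-- Smooth vector fields. -/
def SmoothVF (X : VField E M) [IsManifold 𝓘(ℝ, E) ∞ M] : Prop :=
  ContMDiff 𝓘(ℝ, E) 𝓘(ℝ, E).tangent ∞ (fun x => (⟨x, X x⟩ : TangentBundle 𝓘(ℝ, E) M))

/-- The expression of a form in the preferred chart around `x₀`: its pullback under the inverse of
the chart. Only its values on the target of the chart are meaningful. -/
def inChart {n : ℕ} (Ω : DForm E M F n) (x₀ : M) (y : E) : E [⋀^Fin n]→L[ℝ] F :=
  (Ω ((extChartAt 𝓘(ℝ, E) x₀).symm y)).compContinuousLinearMap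
    (mfderiv 𝓘(ℝ, E) 𝓘(ℝ, E) (extChartAt 𝓘(ℝ, E) x₀).symm y : E →L[ℝ] _)

/-- A form is smooth if its expressions in charts are smooth. -/
def SmoothForm {n : ℕ} (Ω : DForm E M F n) : Prop :=
  ∀ x₀ : M, ContDiffOn ℝ ∞ (inChart Ω x₀) (extChartAt 𝓘(ℝ, E) x₀).target

/-- The exterior derivative of a form on a manifold, computed in the chart around each point. -/
def extD {n : ℕ} (Ω : DForm E M F n) : DForm E M F (n + 1) := fun x₀ =>
  (extDeriv (inChart Ω x₀) (extChartAt 𝓘(ℝ, E) x₀ x₀)).compContinuousLinearMap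
    (mfderiv 𝓘(ℝ, E) 𝓘(ℝ, E) (extChartAt 𝓘(ℝ, E) x₀) x₀ : _ →L[ℝ] E)

/-- The kernel at `x` of a one-form. -/
def ker₁ (η : DForm E M F 1) (x : M) : Submodule ℝ (TangentSpace 𝓘(ℝ, E) x) where
  carrier := {v | η x ![v] = 0}
  add_mem' := by
    intro v w hv hw
    have h : η x ![v + w] = η x ![v] + η x ![w] := (η x).map_vecCons_add ![] v w
    have hv' : η x ![v] = 0 := hv
    have hw' : η x ![w] = 0 := hw
    exact h.trans (by rw [hv', hw', add_zero])
  zero_mem' := (η x).map_coord_zero 0 rfl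
  smul_mem' := by
    intro c v hv
    have h : η x ![c • v] = c • η x ![v] := (η x).map_vecCons_smul ![] c v
    have hv' : η x ![v] = 0 := hv
    exact h.trans (by rw [hv', smul_zero])

/-- The kernel at `x` of a two-form: the vectors `v` with `ι_v Ω = 0`. -/
def ker₂ (Ω : DForm E M F 2) (x : M) : Submodule ℝ (TangentSpace 𝓘(ℝ, E) x) where
  carrier := {v | ∀ w, Ω x ![v, w] = 0}
  add_mem' := by
    intro v v' hv hv' w
    have h : Ω x ![v + v', w] = Ω x ![v, w] + Ω x ![v', w] := (Ω x).map_vecCons_add ![w] v v'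
    rw [h, hv w, hv' w, add_zero]
  zero_mem' := fun w => (Ω x).map_coord_zero 0 rfl
  smul_mem' := by
    intro c v hv w
    have h : Ω x ![c • v, w] = c • Ω x ![v, w] := (Ω x).map_vecCons_smul ![w] c v
    rw [h, hv w, smul_zero]

/-- The real-valued form `⟨β, θ⟩` obtained from an `F`-valued form `β` and a covector `θ`. -/
def pairForm {n : ℕ} (β : DForm E M F n) (θ : F →L[ℝ] ℝ) : DForm E M ℝ n :=
  fun x => θ.compContinuousAlternatingMap (β x)

end Forms

section Contact

variable {E : Type*} [NormedAddCommGroup E] [NormedSpace ℝ E]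
variable {M : Type*} [TopologicalSpace M] [ChartedSpace E M]
variable {k : ℕ}

/-- A `k`-contact form on `M`: a smooth `ℝ^k`-valued one-form `η` such that `ker η` is a non-zero
regular distribution of corank `k`, `ker dη` is a regular distribution of rank `k`, and
`ker η ∩ ker dη = 0`. -/
structure IsKContactForm (η : DForm E M (Fin k → ℝ) 1) : Prop where
  smooth : SmoothForm η
  ker_ne_bot : ∀ x, ker₁ η x ≠ ⊥
  corank_ker : ∀ x, Module.finrank ℝ (TangentSpace 𝓘(ℝ, E) x ⧸ ker₁ η x) = k
  rank_ker_extD : ∀ x, Module.finrank ℝ (ker₂ (extD η) x) = k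
  ker_inf_ker : ∀ x, ker₁ η x ⊓ ker₂ (extD η) x = ⊥

/-- `v` is the value at `x` of the `α`-th Reeb vector field:
`η^β(v) = δ_α^β` and `ι_v dη^β = 0` for all `β`. -/
def IsReebVector (η : DForm E M (Fin k → ℝ) 1) (α : Fin k) (x : M)
    (v : TangentSpace 𝓘(ℝ, E) x) : Prop :=
  η x ![v] = Pi.single α 1 ∧ ∀ w, extD η x ![v, w] = 0

/-- The `α`-th Reeb vector field `R_α`; `isReebVector_reeb` and `IsReebVector.unique` show that
for a `k`-contact form its defining conditions hold and determine it. -/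
def reeb (η : DForm E M (Fin k → ℝ) 1) (α : Fin k) : VField E M :=
  fun x => Classical.epsilon (IsReebVector η α x)

theorem isReebVector_reeb [FiniteDimensional ℝ E] {η : DForm E M (Fin k → ℝ) 1}
    (hη : IsKContactForm η) (α : Fin k) (x : M) : IsReebVector η α x (reeb η α x) := by
  have : FiniteDimensional ℝ (TangentSpace 𝓘(ℝ, E) x) := inferInstanceAs (FiniteDimensional ℝ E)
  apply Classical.epsilon_spec (p := IsReebVector η α x)
  let L : TangentSpace 𝓘(ℝ, E) x →ₗ[ℝ] (Fin k → ℝ) :=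
    { toFun := fun v => η x ![v]
      map_add' := fun v w => (η x).map_vecCons_add ![] v w
      map_smul' := fun c v => (η x).map_vecCons_smul ![] c v }
  let L' := L.domRestrict (ker₂ (extD η) x)
  have hinj : Function.Injective L' := by
    rw [← LinearMap.ker_eq_bot, LinearMap.ker_eq_bot']
    intro v hv
    have h : (v : TangentSpace 𝓘(ℝ, E) x) ∈ ker₁ η x ⊓ ker₂ (extD η) x := ⟨hv, v.2⟩
    rw [hη.ker_inf_ker x] at h
    exact Subtype.ext h
  have hsurj : Function.Surjective L' := by
    refine (LinearMap.injective_iff_surjective_of_finrank_eq_finrank ?_).1 hinj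
    rw [hη.rank_ker_extD x]; simp
  obtain ⟨v, hv⟩ := hsurj (Pi.single α 1)
  exact ⟨v, hv, v.2⟩

theorem IsReebVector.unique {η : DForm E M (Fin k → ℝ) 1}
    (hη : IsKContactForm η) {α : Fin k} {x : M} {v w : TangentSpace 𝓘(ℝ, E) x}
    (hv : IsReebVector η α x v) (hw : IsReebVector η α x w) : v = w := by
  have h : v - w ∈ ker₁ η x ⊓ ker₂ (extD η) x := by
    refine ⟨?_, (ker₂ (extD η) x).sub_mem hv.2 hw.2⟩
    have h1 : η x ![v - w + w] = η x ![v - w] + η x ![w] :=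
      (η x).map_vecCons_add ![] (v - w) w
    rw [sub_add_cancel] at h1
    have h2 : η x ![v] = η x ![w] := hv.1.trans hw.1.symm
    exact add_eq_right.1 (h1.symm.trans h2)
  rw [hη.ker_inf_ker x] at h
  exact sub_eq_zero.1 h

variable [IsManifold 𝓘(ℝ, E) ∞ M]

/-- `X` is an `η`-Hamiltonian vector field: a smooth Lie symmetry of the distribution `ker η`,
that is, `[X, Y]` takes values in `ker η` for each smooth `Y` that does. -/
def IsEtaHamiltonianVF (η : DForm E M (Fin k → ℝ) 1) (X : VField E M) : Prop :=
  SmoothVF X ∧ ∀ Y : VField E M, SmoothVF Y → (∀ x, Y x ∈ ker₁ η x) →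
    ∀ x, VectorField.mlieBracket 𝓘(ℝ, E) X Y x ∈ ker₁ η x

/-- `X` is an `η`-Hamiltonian vector field and `f = -ι_X η` is its `η`-Hamiltonian `k`-function. -/
def IsEtaHamiltonianPair (η : DForm E M (Fin k → ℝ) 1) (X : VField E M)
    (f : M → (Fin k → ℝ)) : Prop :=
  IsEtaHamiltonianVF η X ∧ ∀ x, f x = - η x ![X x]

/-- `f` is an `η`-Hamiltonian `k`-function. -/
def IsEtaHamiltonianKFun (η : DForm E M (Fin k → ℝ) 1) (f : M → (Fin k → ℝ)) : Prop :=
  ∃ X : VField E M, IsEtaHamiltonianPair η X f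

/-- The `η`-Hamiltonian vector field `X_f` of an `η`-Hamiltonian `k`-function `f`
(for a `k`-contact form it is uniquely determined by `f`). -/
def etaHamVF (η : DForm E M (Fin k → ℝ) 1) (f : M → (Fin k → ℝ)) : VField E M :=
  Classical.epsilon (fun X => IsEtaHamiltonianPair η X f)

/-- The bracket `{f, g}_η = η([X_f, X_g])` of `η`-Hamiltonian `k`-functions. -/
def etaBracket (η : DForm E M (Fin k → ℝ) 1) (f g : M → (Fin k → ℝ)) : M → (Fin k → ℝ) :=
  fun x => η x ![VectorField.mlieBracket 𝓘(ℝ, E) (etaHamVF η f) (etaHamVF η g) x]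

/-- `f` is annihilated by all the Reeb vector fields of `η`. -/
def ReebInvariant (η : DForm E M (Fin k → ℝ) 1) (f : M → (Fin k → ℝ)) : Prop :=
  ∀ (α : Fin k) (x : M), mfderiv 𝓘(ℝ, E) 𝓘(ℝ, Fin k → ℝ) f x (reeb η α x) = 0

/-- The `t`-dependent vector field `X` is a Lie system admitting `W` as an `η`-Lie–Hamilton
algebra: each `X_t` is the `η`-Hamiltonian vector field of some `h_t ∈ W`. -/
def AdmitsLieHamiltonAlgebra (η : DForm E M (Fin k → ℝ) 1)
    (W : Submodule ℝ (M → (Fin k → ℝ))) (X : ℝ → VField E M) : Prop :=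
  ∀ t, ∃ f ∈ W, IsEtaHamiltonianPair η (X t) f

end Contact

section Presymplectic

variable {E : Type*} [NormedAddCommGroup E] [NormedSpace ℝ E]
variable {M : Type*} [TopologicalSpace M] [ChartedSpace E M]

/-- A presymplectic form: a smooth closed real-valued two-form, not necessarily of constant rank. -/
def IsPresymplectic (Ω : DForm E M ℝ 2) : Prop :=
  SmoothForm Ω ∧ extD Ω = 0

/-- `ι_v Ω = df` at the point `x`. -/
def IsHamiltonianVector (Ω : DForm E M ℝ 2) (f : M → ℝ) (x : M)
    (v : TangentSpace 𝓘(ℝ, E) x) : Prop :=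
  ∀ w, Ω x ![v, w] = mfderiv 𝓘(ℝ, E) 𝓘(ℝ, ℝ) f x w

/-- A Hamiltonian function of `Ω`: a smooth `f` with `ι_X Ω = df` for a smooth vector field `X`. -/
def IsHamiltonianFunction [IsManifold 𝓘(ℝ, E) ∞ M] (Ω : DForm E M ℝ 2) (f : M → ℝ) : Prop :=
  ContMDiff 𝓘(ℝ, E) 𝓘(ℝ, ℝ) ∞ f ∧
    ∃ X : VField E M, SmoothVF X ∧ ∀ x, IsHamiltonianVector Ω f x (X x)

/-- An admissible function of `Ω`: a smooth `f` such that `df` takes values in the image of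
`v ↦ ι_v Ω`. Each Hamiltonian function is admissible. -/
def IsAdmissible (Ω : DForm E M ℝ 2) (f : M → ℝ) : Prop :=
  ContMDiff 𝓘(ℝ, E) 𝓘(ℝ, ℝ) ∞ f ∧ ∀ x, ∃ v, IsHamiltonianVector Ω f x v

/-- The Poisson bracket `{f, g}_Ω = Ω(X_f, X_g)` of admissible functions, where
`ι_{X_f} Ω = df` and `ι_{X_g} Ω = dg`; by `poissonBracket_eq` the choices do not matter. -/
def poissonBracket (Ω : DForm E M ℝ 2) (f g : M → ℝ) : M → ℝ := fun x =>
  Ω x ![Classical.epsilon (IsHamiltonianVector Ω f x), Classical.epsilon (IsHamiltonianVector Ω g x)]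

theorem poissonBracket_eq (Ω : DForm E M ℝ 2) {f g : M → ℝ} {x : M}
    {v w : TangentSpace 𝓘(ℝ, E) x} (hv : IsHamiltonianVector Ω f x v)
    (hw : IsHamiltonianVector Ω g x w) : poissonBracket Ω f g x = Ω x ![v, w] := by
  have hv' := Classical.epsilon_spec (p := IsHamiltonianVector Ω f x) ⟨v, hv⟩
  have hw' := Classical.epsilon_spec (p := IsHamiltonianVector Ω g x) ⟨w, hw⟩
  have swap : ∀ a b : TangentSpace 𝓘(ℝ, E) x, Ω x ![a, b] = - Ω x ![b, a] := by
    intro a b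
    have h : Ω x (![b, a] ∘ Equiv.swap 0 1) = - Ω x ![b, a] :=
      (Ω x).map_swap ![b, a] (i := 0) (j := 1) (by decide)
    have e : ![b, a] ∘ Equiv.swap 0 1 = ![a, b] := by
      funext i
      fin_cases i <;> simp
    rw [← h, e]
  unfold poissonBracket
  rw [hv', ← hv, swap, hw', ← hw, ← swap]

/-- `C` is a constant of motion of the `t`-dependent vector field `X`: it is constant along each
solution `γ` of `dγ/dt = X(t, γ)` defined on an interval. -/
def IsConstantOfMotion (X : ℝ → VField E M) (C : M → ℝ) : Prop :=
  ∀ (J : Set ℝ) (γ : ℝ → M), J.OrdConnected →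
    (∀ t ∈ J, HasMFDerivWithinAt 𝓘(ℝ, ℝ) 𝓘(ℝ, E) γ J t
      ((1 : ℝ →L[ℝ] ℝ).smulRight (X t (γ t)))) →
    ∀ s ∈ J, ∀ t ∈ J, C (γ s) = C (γ t)

end Presymplectic

section LieAlgebras

variable {A : Type*} [AddCommGroup A] [Module ℝ A]

/-- The linear subspace `V` is a Lie algebra under the restriction of the operation `br`. -/
structure IsLieAlgebra (V : Submodule ℝ A) (br : A → A → A) : Prop where
  closed : ∀ a ∈ V, ∀ b ∈ V, br a b ∈ V
  add_left : ∀ a ∈ V, ∀ b ∈ V, ∀ c ∈ V, br (a + b) c = br a c + br b c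
  add_right : ∀ a ∈ V, ∀ b ∈ V, ∀ c ∈ V, br a (b + c) = br a b + br a c
  smul_right : ∀ (r : ℝ), ∀ a ∈ V, ∀ b ∈ V, br a (r • b) = r • br a b
  self : ∀ a ∈ V, br a a = 0
  jacobi : ∀ a ∈ V, ∀ b ∈ V, ∀ c ∈ V, br a (br b c) = br (br a b) c + br b (br a c)

/-- The Lie ring structure on `V` with bracket `br`. -/
abbrev IsLieAlgebra.lieRing {V : Submodule ℝ A} {br : A → A → A} (h : IsLieAlgebra V br) :
    LieRing V where
  bracket a b := ⟨br a b, h.closed a a.2 b b.2⟩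
  add_lie a b c := Subtype.ext (h.add_left a a.2 b b.2 c c.2)
  lie_add a b c := Subtype.ext (h.add_right a a.2 b b.2 c c.2)
  lie_self a := Subtype.ext (h.self a a.2)
  leibniz_lie a b c := Subtype.ext (h.jacobi a a.2 b b.2 c c.2)

/-- The real Lie algebra structure on `V` with bracket `br`. -/
abbrev IsLieAlgebra.lieAlgebra {V : Submodule ℝ A} {br : A → A → A} (h : IsLieAlgebra V br) :
    @LieAlgebra ℝ V _ h.lieRing :=
  letI := h.lieRing
  { lie_smul := fun r a b => Subtype.ext (h.smul_right r a a.2 b b.2) }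

end LieAlgebras

end KContact

end

/-!
A `k`-contact form splits each tangent space as `ker η ⊕ ker dη`, the second summand being spanned
by the Reeb vectors. Evaluating `dη` on an `η`-Hamiltonian field `X` and on sections of `ker η`
shows that `dη(X, ·) = df` on `ker η`, where `f = -ι_X η`. Since `dη(X, ·)` vanishes on `ker dη`,
the function `f` determines `X`; and if `f` is invariant under the Reeb fields, then
`dη(X, ·) = df` on the whole tangent space, so that `X` is a Hamiltonian vector field of `⟨f, θ⟩`
with respect to `ω`.

By uniqueness, `X ↦ -ι_X η` transports the Lie algebra of `η`-Hamiltonian fields, taken with the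
opposite of the Lie bracket, to the functions with `{·, ·}_η`. For Reeb-invariant functions the
invariant formula for `dη` gives `{f, g}_η = dη(X_f, X_g)`, whence
`⟨{f, g}_η, θ⟩ = {⟨f, θ⟩, ⟨g, θ⟩}_ω`, and the Lie algebra structure is transported once more.
Finally `{C, ⟨f, θ⟩}_ω = dC(X_f)`, so a function `C` that Poisson commutes with all `⟨f, θ⟩` is
constant along the integral curves.
-/

noncomputable section

namespace KContact

open Set Filter Topology VectorField

section LieAlgebraTransport

variable {A B : Type*} [AddCommGroup A] [Module ℝ A] [AddCommGroup B] [Module ℝ B]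

theorem IsLieAlgebra.mono {V W : Submodule ℝ A} {br : A → A → A} (h : IsLieAlgebra V br)
    (hWV : W ≤ V) (hW : ∀ a ∈ W, ∀ b ∈ W, br a b ∈ W) : IsLieAlgebra W br where
  closed := hW
  add_left a ha b hb c hc := h.add_left a (hWV ha) b (hWV hb) c (hWV hc)
  add_right a ha b hb c hc := h.add_right a (hWV ha) b (hWV hb) c (hWV hc)
  smul_right r a ha b hb := h.smul_right r a (hWV ha) b (hWV hb)
  self a ha := h.self a (hWV ha)
  jacobi a ha b hb c hc := h.jacobi a (hWV ha) b (hWV hb) c (hWV hc)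

theorem IsLieAlgebra.map {V : Submodule ℝ A} {br : A → A → A} (h : IsLieAlgebra V br)
    (L : A →ₗ[ℝ] B) {br' : B → B → B} (hL : ∀ a ∈ V, ∀ b ∈ V, br' (L a) (L b) = L (br a b)) :
    IsLieAlgebra (V.map L) br' where
  closed := by
    rintro _ ⟨a, ha, rfl⟩ _ ⟨b, hb, rfl⟩
    exact ⟨br a b, h.closed a ha b hb, (hL a ha b hb).symm⟩
  add_left := by
    rintro _ ⟨a, ha, rfl⟩ _ ⟨b, hb, rfl⟩ _ ⟨c, hc, rfl⟩
    rw [← map_add, hL _ (V.add_mem ha hb) c hc, h.add_left a ha b hb c hc, map_add,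
      hL a ha c hc, hL b hb c hc]
  add_right := by
    rintro _ ⟨a, ha, rfl⟩ _ ⟨b, hb, rfl⟩ _ ⟨c, hc, rfl⟩
    rw [← map_add, hL a ha _ (V.add_mem hb hc), h.add_right a ha b hb c hc, map_add,
      hL a ha b hb, hL a ha c hc]
  smul_right := by
    rintro r _ ⟨a, ha, rfl⟩ _ ⟨b, hb, rfl⟩
    rw [← map_smul, hL a ha _ (V.smul_mem r hb), h.smul_right r a ha b hb, map_smul, hL a ha b hb]
  self := by
    rintro _ ⟨a, ha, rfl⟩
    rw [hL a ha a ha, h.self a ha, map_zero]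
  jacobi := by
    rintro _ ⟨a, ha, rfl⟩ _ ⟨b, hb, rfl⟩ _ ⟨c, hc, rfl⟩
    have hab := h.closed a ha b hb
    have hac := h.closed a ha c hc
    have hbc := h.closed b hb c hc
    rw [hL b hb c hc, hL a ha _ hbc, hL a ha b hb, hL _ hab c hc, hL a ha c hc, hL b hb _ hac,
      h.jacobi a ha b hb c hc, map_add]

theorem IsLieAlgebra.exists_surjective_lieHom {V : Submodule ℝ A} {br : A → A → A}
    (h : IsLieAlgebra V br) (L : A →ₗ[ℝ] B) {br' : B → B → B} (h' : IsLieAlgebra (V.map L) br')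
    (hL : ∀ a ∈ V, ∀ b ∈ V, br' (L a) (L b) = L (br a b)) :
    letI := h.lieRing
    letI := h.lieAlgebra
    letI := h'.lieRing
    letI := h'.lieAlgebra
    ∃ φ : V →ₗ⁅ℝ⁆ V.map L, (∀ a : V, (φ a : B) = L a) ∧ Function.Surjective φ := by
  let _ := h.lieRing
  let _ := h.lieAlgebra
  let _ := h'.lieRing
  let _ := h'.lieAlgebra
  refine ⟨{ L.submoduleMap V with
    map_lie' := fun {a b} => Subtype.ext (hL a a.2 b b.2).symm }, fun _ => rfl, ?_⟩
  exact L.submoduleMap_surjective V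

end LieAlgebraTransport

section NormedSpaces

variable {E : Type*} [NormedAddCommGroup E] [NormedSpace ℝ E]
variable {E' : Type*} [NormedAddCommGroup E'] [NormedSpace ℝ E']
variable {F : Type*} [NormedAddCommGroup F] [NormedSpace ℝ F]

variable (E F) in
/-- The identification of alternating one-forms on `E` with continuous linear maps, used to apply
the calculus of the latter to the former. -/
def oneFormCLM : (E [⋀^Fin 1]→L[ℝ] F) ≃ₗᵢ[ℝ] (E →L[ℝ] F) :=
  (ContinuousAlternatingMap.ofSubsingletonLIE (𝕜 := ℝ) (E := E) (F := F) (0 : Fin 1)).symm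

theorem oneFormCLM_apply (α : E [⋀^Fin 1]→L[ℝ] F) (v : E) : oneFormCLM E F α v = α ![v] :=
  congrArg α (Matrix.vec_single_eq_const v).symm

theorem contDiffAt_oneForm_apply {n : WithTop ℕ∞} {α : E' → E [⋀^Fin 1]→L[ℝ] F} {V : E' → E}
    {y : E'} (hα : ContDiffAt ℝ n α y) (hV : ContDiffAt ℝ n V y) :
    ContDiffAt ℝ n (fun z => α z ![V z]) y := by
  simp only [← oneFormCLM_apply]
  exact ((oneFormCLM E F).contDiff.contDiffAt.comp y hα).clm_apply hV

theorem extDeriv_compContinuousAlternatingMap {F' : Type*} [NormedAddCommGroup F']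
    [NormedSpace ℝ F'] {n : ℕ} {α : E → E [⋀^Fin n]→L[ℝ] F} {y : E}
    (hα : DifferentiableAt ℝ α y) (θ : F →L[ℝ] F') :
    extDeriv (fun z => θ.compContinuousAlternatingMap (α z)) y =
      θ.compContinuousAlternatingMap (extDeriv α y) := by
  let T := ContinuousLinearMap.compContinuousAlternatingMapCLM ℝ E F F' (Fin n) θ
  have hT : fderiv ℝ (fun z => θ.compContinuousAlternatingMap (α z)) y = T ∘L fderiv ℝ α y :=
    (T.hasFDerivAt.comp y hα.hasFDerivAt).fderiv
  ext v
  simp [extDeriv, hT, ContinuousAlternatingMap.alternatizeUncurryFin_apply, T]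

theorem extDeriv_oneForm_apply_vectorField {α : E → E [⋀^Fin 1]→L[ℝ] F} {V W : E → E} {y : E}
    (hα : DifferentiableAt ℝ α y) (hV : DifferentiableAt ℝ V y) (hW : DifferentiableAt ℝ W y) :
    extDeriv α y ![V y, W y] = fderiv ℝ (fun z => α z ![W z]) y (V y) -
      fderiv ℝ (fun z => α z ![V z]) y (W y) - α y ![lieBracket ℝ V W y] := by
  have h := extDeriv_apply_vectorField (V := ![V, W]) hα (fun i => by fin_cases i <;> assumption)
  have e : (fun i => ![V, W] i y) = ![V y, W y] := by
    funext i; fin_cases i <;> rfl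
  have e₀ (z : E) : Fin.removeNth 0 (fun i => ![V, W] i z) = ![W z] := by
    funext i; fin_cases i; rfl
  have e₁ (z : E) : Fin.removeNth 1 (fun i => ![V, W] i z) = ![V z] := by
    funext i; fin_cases i; rfl
  rw [e, Fin.sum_univ_two] at h
  simp only [e₀, e₁] at h
  rw [h]
  simp [sub_eq_add_neg]

theorem exists_contDiffAt_mem_ker [CompleteSpace F] {n : WithTop ℕ∞} {L : E → E' →L[ℝ] F} {y₀ : E}
    (hL : ∀ᶠ y in 𝓝 y₀, ContDiffAt ℝ n L y) {S : F →L[ℝ] E'} (hS : L y₀ ∘L S = .id ℝ F) {v : E'}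
    (hv : L y₀ v = 0) :
    ∃ V : E → E', V y₀ = v ∧ (∀ᶠ y in 𝓝 y₀, ContDiffAt ℝ n V y) ∧ ∀ᶠ y in 𝓝 y₀, L y (V y) = 0 := by
  have hLS : ∀ᶠ y in 𝓝 y₀, ContDiffAt ℝ n (fun y => L y ∘L S) y :=
    hL.mono fun y hy => hy.clm_comp contDiffAt_const
  have hunit : ∀ᶠ y in 𝓝 y₀, IsUnit (L y ∘L S) :=
    hLS.self_of_nhds.continuousAt.eventually_mem
      (Units.isOpen.mem_nhds (by rw [hS]; exact isUnit_one))
  -- project `v` onto `ker (L y)` along the range of `S`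
  refine ⟨fun y => v - S (Ring.inverse (L y ∘L S) (L y v)), by simp [hv], ?_, ?_⟩
  · filter_upwards [hL, hLS, hunit] with y hLy hLSy ⟨u, hu⟩
    have hinv : ContDiffAt ℝ n Ring.inverse (L y ∘L S) := hu ▸ contDiffAt_ringInverse ℝ u
    exact contDiffAt_const.sub (S.contDiff.contDiffAt.comp y
      ((hinv.comp y hLSy).clm_apply (hLy.clm_apply contDiffAt_const)))
  · filter_upwards [hunit] with y hy
    have h : L y (S (Ring.inverse (L y ∘L S) (L y v))) = L y v :=
      congrArg (fun B : F →L[ℝ] F => B (L y v)) (Ring.mul_inverse_cancel _ hy)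
    rw [map_sub, h, sub_self]

end NormedSpaces

section PointwiseForms

variable {E : Type*} [NormedAddCommGroup E] [NormedSpace ℝ E]
variable {M : Type*} [TopologicalSpace M] [ChartedSpace E M]
variable {F : Type*} [NormedAddCommGroup F] [NormedSpace ℝ F]

/-- The value `v ↦ ι_v η` of a one-form at a point, as a linear map; its kernel is `ker₁ η x`. -/
def evalOne (η : DForm E M F 1) (x : M) : TangentSpace 𝓘(ℝ, E) x →ₗ[ℝ] F where
  toFun v := η x ![v]
  map_add' v w := (η x).map_vecCons_add ![] v w
  map_smul' c v := (η x).map_vecCons_smul ![] c v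

/-- The interior product `X ↦ ι_X η` of vector fields with a one-form. -/
def contract (η : DForm E M F 1) : VField E M →ₗ[ℝ] (M → F) :=
  LinearMap.pi fun x => evalOne η x ∘ₗ LinearMap.proj x

theorem contract_apply (η : DForm E M F 1) (X : VField E M) (x : M) :
    contract η X x = η x ![X x] := rfl

/-- The interior product `ι_v Ω` of a tangent vector with a two-form, as a linear map. -/
def evalTwo (Ω : DForm E M F 2) (x : M) (v : TangentSpace 𝓘(ℝ, E) x) :
    TangentSpace 𝓘(ℝ, E) x →ₗ[ℝ] F :=
  (Ω x).toMultilinearMap.toLinearMap ![v, 0] 1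

theorem evalTwo_apply (Ω : DForm E M F 2) (x : M) (v w : TangentSpace 𝓘(ℝ, E) x) :
    evalTwo Ω x v w = Ω x ![v, w] :=
  congrArg (Ω x) (by funext i; fin_cases i <;> rfl)

theorem twoForm_swap (Ω : DForm E M F 2) (x : M) (v w : TangentSpace 𝓘(ℝ, E) x) :
    Ω x ![v, w] = -Ω x ![w, v] := by
  have h := (Ω x).map_swap ![w, v] (i := 0) (j := 1) (by decide)
  rwa [show ![w, v] ∘ Equiv.swap 0 1 = ![v, w] by funext i; fin_cases i <;> rfl] at h

end PointwiseForms

section ExteriorDerivative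

variable {E : Type*} [NormedAddCommGroup E] [NormedSpace ℝ E]
variable {M : Type*} [TopologicalSpace M] [ChartedSpace E M]
variable {F : Type*} [NormedAddCommGroup F] [NormedSpace ℝ F] {n : ℕ}

theorem minSmoothness_natCast_le_infty (m : ℕ) : minSmoothness ℝ m ≤ ∞ := by
  rw [minSmoothness_of_isRCLikeNormedField]
  exact WithTop.coe_le_coe.2 le_top

theorem SmoothForm.contDiffAt {Ω : DForm E M F n} (hΩ : SmoothForm Ω) (x₀ : M) {y : E}
    (hy : y ∈ (extChartAt 𝓘(ℝ, E) x₀).target) : ContDiffAt ℝ ∞ (inChart Ω x₀) y :=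
  (hΩ x₀).contDiffAt ((isOpen_extChartAt_target x₀).mem_nhds hy)

theorem SmoothForm.differentiableAt_self {Ω : DForm E M F n} (hΩ : SmoothForm Ω) (x : M) :
    DifferentiableAt ℝ (inChart Ω x) (extChartAt 𝓘(ℝ, E) x x) :=
  (hΩ.contDiffAt x (mem_extChartAt_target x)).differentiableAt (by simp)

protected theorem SmoothForm.pairForm {β : DForm E M F n} (hβ : SmoothForm β) (θ : F →L[ℝ] ℝ) :
    SmoothForm (pairForm β θ) := fun x₀ =>
  (ContinuousLinearMap.compContinuousAlternatingMapCLM ℝ E F ℝ (Fin n) θ).contDiff.comp_contDiffOn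
    (hβ x₀)

theorem extD_pairForm {β : DForm E M F n} (hβ : SmoothForm β) (θ : F →L[ℝ] ℝ) :
    extD (pairForm β θ) = pairForm (extD β) θ := by
  funext x
  have h : extDeriv (inChart (pairForm β θ) x) (extChartAt 𝓘(ℝ, E) x x) =
      θ.compContinuousAlternatingMap (extDeriv (inChart β x) (extChartAt 𝓘(ℝ, E) x x)) :=
    extDeriv_compContinuousAlternatingMap (hβ.differentiableAt_self x) θ
  rw [extD, h]
  rfl

/-- The change from the preferred chart around `x₀` to the one around `x₁`. -/
def transition (x₀ x₁ : M) : E → E := extChartAt 𝓘(ℝ, E) x₁ ∘ (extChartAt 𝓘(ℝ, E) x₀).symm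

variable (E) in
/-- The domain of `transition x₀ x₁`. -/
def transitionSource (x₀ x₁ : M) : Set E :=
  (extChartAt 𝓘(ℝ, E) x₀).target ∩
    (extChartAt 𝓘(ℝ, E) x₀).symm ⁻¹' (extChartAt 𝓘(ℝ, E) x₁).source

theorem isOpen_transitionSource (x₀ x₁ : M) : IsOpen (transitionSource E x₀ x₁) :=
  (continuousOn_extChartAt_symm x₀).isOpen_inter_preimage (isOpen_extChartAt_target x₀)
    (isOpen_extChartAt_source x₁)

theorem inChart_extChartAt (Ω : DForm E M F n) (x₀ : M) {z : M}
    (hz : z ∈ (extChartAt 𝓘(ℝ, E) x₀).source) :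
    inChart Ω x₀ (extChartAt 𝓘(ℝ, E) x₀ z) = (Ω z).compContinuousLinearMap
      (mfderiv 𝓘(ℝ, E) 𝓘(ℝ, E) (extChartAt 𝓘(ℝ, E) x₀).symm (extChartAt 𝓘(ℝ, E) x₀ z) :
        E →L[ℝ] E) := by
  have h {p q : M} (hpq : p = q) (A : E →L[ℝ] E) :
      (Ω p).compContinuousLinearMap (A : E →L[ℝ] TangentSpace 𝓘(ℝ, E) p) =
        (Ω q).compContinuousLinearMap (A : E →L[ℝ] TangentSpace 𝓘(ℝ, E) q) := by
    subst hpq; rfl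
  exact h ((extChartAt 𝓘(ℝ, E) x₀).left_inv hz) _

variable [IsManifold 𝓘(ℝ, E) ∞ M]

variable (E M) in
theorem isManifold_one : IsManifold 𝓘(ℝ, E) 1 M := .of_le (n := ∞) (by decide)

theorem mfderiv_symm_mfderiv_extChartAt (x₀ : M) {z : M}
    (hz : z ∈ (extChartAt 𝓘(ℝ, E) x₀).source) (v : E) :
    (mfderiv 𝓘(ℝ, E) 𝓘(ℝ, E) (extChartAt 𝓘(ℝ, E) x₀).symm (extChartAt 𝓘(ℝ, E) x₀ z) : E →L[ℝ] E)
      ((mfderiv 𝓘(ℝ, E) 𝓘(ℝ, E) (extChartAt 𝓘(ℝ, E) x₀) z : E →L[ℝ] E) v) = v := by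
  have := isManifold_one E M
  have h := mfderivWithin_extChartAt_symm_comp_mfderiv_extChartAt' (I := 𝓘(ℝ, E)) hz
  rw [ModelWithCorners.range_eq_univ, mfderivWithin_univ] at h
  exact congrArg (fun L : E →L[ℝ] E => L v) h

theorem mdifferentiableAt_extChartAt_symm (x₀ : M) {y : E}
    (hy : y ∈ (extChartAt 𝓘(ℝ, E) x₀).target) :
    MDifferentiableAt 𝓘(ℝ, E) 𝓘(ℝ, E) (extChartAt 𝓘(ℝ, E) x₀).symm y := by
  have := isManifold_one E M
  have h := mdifferentiableWithinAt_extChartAt_symm (I := 𝓘(ℝ, E)) hy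
  rwa [ModelWithCorners.range_eq_univ, mdifferentiableWithinAt_univ] at h

theorem fderiv_transition {x₀ x₁ : M} {y : E} (hy : y ∈ transitionSource E x₀ x₁) (v : E) :
    fderiv ℝ (transition x₀ x₁) y v =
      (mfderiv 𝓘(ℝ, E) 𝓘(ℝ, E) (extChartAt 𝓘(ℝ, E) x₁) ((extChartAt 𝓘(ℝ, E) x₀).symm y) :
          E →L[ℝ] E)
        ((mfderiv 𝓘(ℝ, E) 𝓘(ℝ, E) (extChartAt 𝓘(ℝ, E) x₀).symm y : E →L[ℝ] E) v) := by
  have := isManifold_one E M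
  have hy₁ : (extChartAt 𝓘(ℝ, E) x₀).symm y ∈ (chartAt E x₁).source :=
    extChartAt_source 𝓘(ℝ, E) x₁ ▸ hy.2
  rw [← mfderiv_eq_fderiv, transition,
    mfderiv_comp y (mdifferentiableAt_extChartAt hy₁) (mdifferentiableAt_extChartAt_symm x₀ hy.1)]
  rfl

theorem contDiffAt_transition {x₀ x₁ : M} {y : E} (hy : y ∈ transitionSource E x₀ x₁) :
    ContDiffAt ℝ ∞ (transition x₀ x₁) y := by
  have h₀ : ContMDiffAt 𝓘(ℝ, E) 𝓘(ℝ, E) ∞ (extChartAt 𝓘(ℝ, E) x₀).symm y :=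
    (contMDiffOn_extChartAt_symm x₀).contMDiffAt ((isOpen_extChartAt_target x₀).mem_nhds hy.1)
  have hy₁ : (extChartAt 𝓘(ℝ, E) x₀).symm y ∈ (chartAt E x₁).source :=
    extChartAt_source 𝓘(ℝ, E) x₁ ▸ hy.2
  exact ((contMDiffAt_extChartAt' hy₁).comp y h₀).contDiffAt

theorem inChart_eq_pullback (Ω : DForm E M F n) {x₀ x₁ : M} {y : E}
    (hy : y ∈ transitionSource E x₀ x₁) :
    inChart Ω x₀ y = (inChart Ω x₁ (transition x₀ x₁ y)).compContinuousLinearMap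
      (fderiv ℝ (transition x₀ x₁) y) := by
  rw [transition, Function.comp_apply, inChart_extChartAt Ω x₁ hy.2]
  ext v
  refine congrArg (Ω ((extChartAt 𝓘(ℝ, E) x₀).symm y)) (funext fun i => ?_)
  exact (mfderiv_symm_mfderiv_extChartAt x₁ hy.2 _).symm.trans
    (congrArg _ (fderiv_transition hy (v i)).symm)

theorem inChart_extD {Ω : DForm E M F n} (hΩ : SmoothForm Ω) (x₀ : M) {y : E}
    (hy : y ∈ (extChartAt 𝓘(ℝ, E) x₀).target) :
    inChart (extD Ω) x₀ y = extDeriv (inChart Ω x₀) y := by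
  set x₁ := (extChartAt 𝓘(ℝ, E) x₀).symm y
  have hy₁ : y ∈ transitionSource E x₀ x₁ := ⟨hy, mem_extChartAt_source x₁⟩
  have hpull : inChart Ω x₀ =ᶠ[𝓝 y] fun z =>
      (inChart Ω x₁ (transition x₀ x₁ z)).compContinuousLinearMap
        (fderiv ℝ (transition x₀ x₁) z) := by
    filter_upwards [(isOpen_transitionSource x₀ x₁).mem_nhds hy₁] with z hz
    exact inChart_eq_pullback Ω hz
  rw [hpull.extDeriv_eq, extDeriv_pullback (r := ∞) (f := transition x₀ x₁)
    (hΩ.differentiableAt_self x₁) (contDiffAt_transition hy₁) (minSmoothness_natCast_le_infty 2)]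
  ext v
  exact congrArg (extDeriv (inChart Ω x₁) (extChartAt 𝓘(ℝ, E) x₁ x₁))
    (funext fun i => (fderiv_transition hy₁ (v i)).symm)

protected theorem SmoothForm.extD {Ω : DForm E M F n} (hΩ : SmoothForm Ω) :
    SmoothForm (extD Ω) := by
  intro x₀
  have h : ContDiffOn ℝ ∞ (extDeriv (inChart Ω x₀)) (extChartAt 𝓘(ℝ, E) x₀).target := by
    refine fun y hy => ContDiffAt.contDiffWithinAt ?_
    exact (ContinuousAlternatingMap.alternatizeUncurryFinCLM ℝ E F).contDiff.contDiffAt.comp y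
      ((hΩ.contDiffAt x₀ hy).fderiv_right (m := ∞) le_rfl)
  exact h.congr fun y hy => inChart_extD hΩ x₀ hy

theorem extD_extD {Ω : DForm E M F n} (hΩ : SmoothForm Ω) : extD (extD Ω) = 0 := by
  funext x
  have hx := mem_extChartAt_target (I := 𝓘(ℝ, E)) x
  have hd : inChart (extD Ω) x =ᶠ[𝓝 (extChartAt 𝓘(ℝ, E) x x)] extDeriv (inChart Ω x) := by
    filter_upwards [(isOpen_extChartAt_target x).mem_nhds hx] with y hy
    exact inChart_extD hΩ x hy
  rw [extD, hd.extDeriv_eq,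
    extDeriv_extDeriv_apply (r := ∞) (hΩ.contDiffAt x hx) (minSmoothness_natCast_le_infty 2)]
  rfl

theorem mfderiv_extChartAt_symm_self (x : M) (v : E) :
    (mfderiv 𝓘(ℝ, E) 𝓘(ℝ, E) (extChartAt 𝓘(ℝ, E) x).symm (extChartAt 𝓘(ℝ, E) x x) : E →L[ℝ] E) v
      = v := by
  have := isManifold_one E M
  have h := mfderivWithin_range_extChartAt_symm (I := 𝓘(ℝ, E)) (x := x)
  rw [ModelWithCorners.range_eq_univ, mfderivWithin_univ] at h
  exact congrArg (fun L : E →L[ℝ] E => L v) h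

theorem inChart_self (Ω : DForm E M F n) (x : M) (v : Fin n → E) :
    inChart Ω x (extChartAt 𝓘(ℝ, E) x x) v = Ω x v := by
  rw [inChart_extChartAt Ω x (mem_extChartAt_source x)]
  exact congrArg (Ω x) (funext fun i => mfderiv_extChartAt_symm_self x (v i))

theorem extD_apply_eq_extDeriv (Ω : DForm E M F n) (x : M) (v : Fin (n + 1) → E) :
    extD Ω x v = extDeriv (inChart Ω x) (extChartAt 𝓘(ℝ, E) x x) v := by
  have := isManifold_one E M
  have h := mfderiv_extChartAt_self (I := 𝓘(ℝ, E)) (x := x)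
  exact congrArg (extDeriv (inChart Ω x) (extChartAt 𝓘(ℝ, E) x x))
    (funext fun i => congrArg (fun L : E →L[ℝ] E => L (v i)) h)

end ExteriorDerivative

section VectorFields

variable {E : Type*} [NormedAddCommGroup E] [NormedSpace ℝ E]
variable {M : Type*} [TopologicalSpace M] [ChartedSpace E M] [IsManifold 𝓘(ℝ, E) ∞ M]
variable {F : Type*} [NormedAddCommGroup F] [NormedSpace ℝ F]

/-- The expression of a vector field in the preferred chart around `x₀`: its pullback under the
inverse of the chart, meaningful on the target of the chart. -/
def chartVF (X : VField E M) (x₀ : M) : E → E :=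
  mpullbackWithin 𝓘(ℝ, E) 𝓘(ℝ, E) (extChartAt 𝓘(ℝ, E) x₀).symm X (range 𝓘(ℝ, E))

theorem mfderiv_symm_chartVF (X : VField E M) (x₀ : M) {y : E}
    (hy : y ∈ (extChartAt 𝓘(ℝ, E) x₀).target) :
    (mfderiv 𝓘(ℝ, E) 𝓘(ℝ, E) (extChartAt 𝓘(ℝ, E) x₀).symm y : E →L[ℝ] E)
      (chartVF (E := E) X x₀ y) =
      X ((extChartAt 𝓘(ℝ, E) x₀).symm y) := by
  have := isManifold_one E M
  have h := (isInvertible_mfderivWithin_extChartAt_symm (I := 𝓘(ℝ, E)) hy).self_apply_inverse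
    (X ((extChartAt 𝓘(ℝ, E) x₀).symm y))
  rw [chartVF, mpullbackWithin_apply]
  rw [ModelWithCorners.range_eq_univ, mfderivWithin_univ] at h ⊢
  exact h

theorem chartVF_self (X : VField E M) (x : M) : chartVF X x (extChartAt 𝓘(ℝ, E) x x) = X x := by
  have h := mfderiv_symm_chartVF X x (mem_extChartAt_target x)
  rw [mfderiv_extChartAt_symm_self] at h
  rw [h]
  exact congrArg (fun z => (X z : E)) (extChartAt_to_inv x)

theorem inChart_chartVF (η : DForm E M F 1) (X : VField E M) (x₀ : M) {y : E}
    (hy : y ∈ (extChartAt 𝓘(ℝ, E) x₀).target) :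
    inChart η x₀ y ![chartVF X x₀ y] = contract η X ((extChartAt 𝓘(ℝ, E) x₀).symm y) := by
  refine congrArg (η ((extChartAt 𝓘(ℝ, E) x₀).symm y)) (funext fun i => ?_)
  fin_cases i
  exact mfderiv_symm_chartVF X x₀ hy

theorem inverse_mfderiv_extChartAt_self (x : M) :
    (mfderiv 𝓘(ℝ, E) 𝓘(ℝ, E) (extChartAt 𝓘(ℝ, E) x) x : E →L[ℝ] E).inverse =
      ContinuousLinearMap.id ℝ E := by
  have := isManifold_one E M
  exact (congrArg (fun L : E →L[ℝ] E => L.inverse)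
    (mfderiv_extChartAt_self (I := 𝓘(ℝ, E)))).trans ContinuousLinearMap.inverse_id

theorem mlieBracket_eq_lieBracket_chartVF (X Y : VField E M) (x : M) :
    mlieBracket 𝓘(ℝ, E) X Y x =
      lieBracket ℝ (chartVF X x) (chartVF Y x) (extChartAt 𝓘(ℝ, E) x x) := by
  have hs : (extChartAt 𝓘(ℝ, E) x).symm ⁻¹' univ ∩ range 𝓘(ℝ, E) = univ := by
    rw [ModelWithCorners.range_eq_univ, preimage_univ, inter_univ]
  rw [← mlieBracketWithin_univ, mlieBracketWithin_apply, hs, ← lieBracketWithin_univ]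
  exact congrArg (fun L : E →L[ℝ] E => L (lieBracketWithin ℝ (chartVF X x) (chartVF Y x) univ
    (extChartAt 𝓘(ℝ, E) x x))) (inverse_mfderiv_extChartAt_self x)

variable (E M) in
/-- The space of smooth vector fields. -/
def smoothFields : Submodule ℝ (VField E M) where
  carrier := {X | SmoothVF X}
  add_mem' hX hY := ContMDiff.add_section hX hY
  zero_mem' := Bundle.contMDiff_zeroSection ℝ _
  smul_mem' _ _ hX := ContMDiff.const_smul_section hX

theorem SmoothVF.mdifferentiableAt {X : VField E M} (hX : SmoothVF X) (x : M) :
    MDifferentiableAt 𝓘(ℝ, E) 𝓘(ℝ, E).tangent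
      (fun x => (⟨x, X x⟩ : TangentBundle 𝓘(ℝ, E) M)) x :=
  (hX x).mdifferentiableAt (by simp)

variable [CompleteSpace E]

theorem SmoothVF.contDiffAt_chartVF {X : VField E M} (hX : SmoothVF X) (x : M) :
    ContDiffAt ℝ ∞ (chartVF X x) (extChartAt 𝓘(ℝ, E) x x) := by
  have h := contMDiffWithinAt_mpullbackWithin_extChartAt_symm (I := 𝓘(ℝ, E)) (n := ∞) (m := ∞)
    (s := univ) (x := x) (hX x).contMDiffWithinAt uniqueMDiffOn_univ (mem_univ x) le_rfl
  rw [preimage_univ, inter_univ] at h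
  exact (contMDiffWithinAt_vectorSpace_iff_contDiffWithinAt.1 h).contDiffAt
    ((isOpen_extChartAt_target x).mem_nhds (mem_extChartAt_target x))

theorem contMDiff_contract {η : DForm E M F 1} (hη : SmoothForm η) {X : VField E M}
    (hX : SmoothVF X) : ContMDiff 𝓘(ℝ, E) 𝓘(ℝ, F) ∞ (contract η X) := by
  intro x
  have h := (contDiffAt_oneForm_apply (hη.contDiffAt x (mem_extChartAt_target x))
    (hX.contDiffAt_chartVF x)).contMDiffAt.comp x (contMDiffAt_extChartAt (I := 𝓘(ℝ, E)) (n := ∞))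
  refine h.congr_of_eventuallyEq ?_
  filter_upwards [extChartAt_source_mem_nhds (I := 𝓘(ℝ, E)) x] with z hz
  have hc := inChart_chartVF η X x ((extChartAt 𝓘(ℝ, E) x).map_source hz)
  rw [(extChartAt 𝓘(ℝ, E) x).left_inv hz] at hc
  exact hc.symm

theorem mvfderiv_contract {η : DForm E M F 1} (hη : SmoothForm η) {X : VField E M}
    (hX : SmoothVF X) (x : M) (v : E) :
    mvfderiv 𝓘(ℝ, E) (contract η X) x v =
      fderiv ℝ (fun y => inChart η x y ![chartVF X x y]) (extChartAt 𝓘(ℝ, E) x x) v := by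
  rw [mvfderiv, ((contMDiff_contract hη hX x).mdifferentiableAt (by simp)).mfderiv,
    ModelWithCorners.range_eq_univ, fderivWithin_univ]
  refine congrArg (fun L : E →L[ℝ] F => L v) (Filter.EventuallyEq.fderiv_eq ?_)
  filter_upwards [(isOpen_extChartAt_target (I := 𝓘(ℝ, E)) x).mem_nhds
    (mem_extChartAt_target x)] with y hy
  exact (inChart_chartVF η X x hy).symm

theorem extD_apply_vectorField {η : DForm E M F 1} (hη : SmoothForm η) {X Y : VField E M}
    (hX : SmoothVF X) (hY : SmoothVF Y) (x : M) :
    extD η x ![X x, Y x] = mvfderiv 𝓘(ℝ, E) (contract η Y) x (X x) -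
      mvfderiv 𝓘(ℝ, E) (contract η X) x (Y x) - contract η (mlieBracket 𝓘(ℝ, E) X Y) x := by
  have h := extDeriv_oneForm_apply_vectorField (hη.differentiableAt_self x)
    ((hX.contDiffAt_chartVF x).differentiableAt (by simp))
    ((hY.contDiffAt_chartVF x).differentiableAt (by simp))
  rw [chartVF_self, chartVF_self, ← mlieBracket_eq_lieBracket_chartVF] at h
  exact (extD_apply_eq_extDeriv η x ![X x, Y x]).trans (h.trans (congrArg₂ (· - ·)
    (congrArg₂ (· - ·) (mvfderiv_contract hη hY x (X x)).symm
      (mvfderiv_contract hη hX x (Y x)).symm) (inChart_self η x _)))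

protected theorem SmoothVF.mlieBracket {X Y : VField E M} (hX : SmoothVF X) (hY : SmoothVF Y) :
    SmoothVF (mlieBracket 𝓘(ℝ, E) X Y) := by
  have : IsManifold 𝓘(ℝ, E) (minSmoothness ℝ 2) M :=
    .of_le (n := ∞) (minSmoothness_natCast_le_infty 2)
  have : IsManifold 𝓘(ℝ, E) (((⊤ : ℕ∞) : WithTop ℕ∞) + 1) M :=
    inferInstanceAs (IsManifold 𝓘(ℝ, E) ∞ M)
  exact ContDiff.mlieBracket_vectorField (m := ⊤) (n := ⊤) hX hY
    (by rw [minSmoothness_of_isRCLikeNormedField]; exact le_rfl)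

theorem SmoothVF.leibniz_mlieBracket {X Y Z : VField E M} (hX : SmoothVF X) (hY : SmoothVF Y)
    (hZ : SmoothVF Z) :
    mlieBracket 𝓘(ℝ, E) X (mlieBracket 𝓘(ℝ, E) Y Z) =
      mlieBracket 𝓘(ℝ, E) (mlieBracket 𝓘(ℝ, E) X Y) Z +
        mlieBracket 𝓘(ℝ, E) Y (mlieBracket 𝓘(ℝ, E) X Z) := by
  have : IsManifold 𝓘(ℝ, E) (minSmoothness ℝ 3) M :=
    .of_le (n := ∞) (minSmoothness_natCast_le_infty 3)
  have h2 : minSmoothness ℝ 2 ≤ ∞ := minSmoothness_natCast_le_infty 2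
  exact funext fun x => leibniz_identity_mlieBracket_apply ((hX x).of_le h2) ((hY x).of_le h2)
    ((hZ x).of_le h2)

theorem SmoothVF.mlieBracket_add_left {X Y : VField E M} (hX : SmoothVF X) (hY : SmoothVF Y)
    (Z : VField E M) :
    mlieBracket 𝓘(ℝ, E) (X + Y) Z = mlieBracket 𝓘(ℝ, E) X Z + mlieBracket 𝓘(ℝ, E) Y Z := by
  have := isManifold_one E M
  exact funext fun x =>
    VectorField.mlieBracket_add_left (hX.mdifferentiableAt x) (hY.mdifferentiableAt x)

theorem SmoothVF.mlieBracket_smul_left {X : VField E M} (hX : SmoothVF X) (c : ℝ)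
    (Z : VField E M) :
    mlieBracket 𝓘(ℝ, E) (c • X) Z = c • mlieBracket 𝓘(ℝ, E) X Z := by
  have := isManifold_one E M
  exact funext fun x => VectorField.mlieBracket_const_smul_left (hX.mdifferentiableAt x)

theorem isLieAlgebra_smoothFields :
    IsLieAlgebra (smoothFields E M) fun X Y => mlieBracket 𝓘(ℝ, E) Y X where
  closed _ hX _ hY := SmoothVF.mlieBracket hY hX
  add_left X hX Y hY Z _ := by
    rw [mlieBracket_swap, SmoothVF.mlieBracket_add_left hX hY, neg_add, ← mlieBracket_swap,
      ← mlieBracket_swap]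
  add_right X _ _ hY _ hZ := SmoothVF.mlieBracket_add_left hY hZ X
  smul_right c X _ _ hY := SmoothVF.mlieBracket_smul_left hY c X
  self X _ := mlieBracket_self
  jacobi X hX Y hY Z hZ := by
    rw [SmoothVF.leibniz_mlieBracket hZ hY hX, mlieBracket_swap (V := Y), neg_add_cancel_right]

end VectorFields

section Extension

variable {E : Type*} [NormedAddCommGroup E] [NormedSpace ℝ E]
variable {M : Type*} [TopologicalSpace M] [ChartedSpace E M] [IsManifold 𝓘(ℝ, E) ∞ M]
variable {F : Type*} [NormedAddCommGroup F] [NormedSpace ℝ F]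

theorem oneForm_mpullback_extChartAt (η : DForm E M F 1) (x : M) {z : M}
    (hz : z ∈ (extChartAt 𝓘(ℝ, E) x).source) (V : E → E) :
    η z ![mpullback 𝓘(ℝ, E) 𝓘(ℝ, E) (extChartAt 𝓘(ℝ, E) x) V z] =
      inChart η x (extChartAt 𝓘(ℝ, E) x z) ![V (extChartAt 𝓘(ℝ, E) x z)] := by
  have := isManifold_one E M
  rw [inChart_extChartAt η x hz]
  refine congrArg (η z) (funext fun i => ?_)
  fin_cases i
  have hinv := (isInvertible_mfderiv_extChartAt (I := 𝓘(ℝ, E)) hz).self_apply_inverse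
    (V (extChartAt 𝓘(ℝ, E) x z))
  exact (mfderiv_symm_mfderiv_extChartAt x hz
    (mpullback 𝓘(ℝ, E) 𝓘(ℝ, E) (extChartAt 𝓘(ℝ, E) x) V z)).symm.trans (congrArg _ hinv)

variable [FiniteDimensional ℝ E]

theorem exists_smoothVF_of_eventually [T2Space M] {x : M} {Z : VField E M}
    {K : ∀ z : M, Submodule ℝ (TangentSpace 𝓘(ℝ, E) z)}
    (hZ : ∀ᶠ z in 𝓝 x, ContMDiffAt 𝓘(ℝ, E) 𝓘(ℝ, E).tangent ∞
      (fun z => (⟨z, Z z⟩ : TangentBundle 𝓘(ℝ, E) M)) z)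
    (hK : ∀ᶠ z in 𝓝 x, Z z ∈ K z) :
    ∃ Y : VField E M, SmoothVF Y ∧ (∀ z, Y z ∈ K z) ∧ Y x = Z x := by
  obtain ⟨N, hN, hNo, hxN⟩ := eventually_nhds_iff.1 (hZ.and hK)
  obtain ⟨b, -, hb⟩ := (SmoothBumpFunction.nhds_basis_tsupport (I := 𝓘(ℝ, E)) x).mem_iff.1
    (hNo.mem_nhds hxN)
  refine ⟨(b : M → ℝ) • Z, ?_, fun z => ?_, ?_⟩
  · exact ContMDiffOn.smul_section_of_tsupport b.contMDiff.contMDiffOn hNo hb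
      fun z hz => (hN z hz).1.contMDiffWithinAt
  · change b z • Z z ∈ K z
    by_cases hz : z ∈ N
    · exact (K z).smul_mem _ (hN z hz).2
    · rw [image_eq_zero_of_notMem_tsupport fun h => hz (hb h), zero_smul]
      exact (K z).zero_mem
  · change b x • Z x = Z x
    rw [b.eq_one, one_smul]

theorem exists_contMDiffAt_mem_ker₁ {η : DForm E M F 1} (hη : SmoothForm η) {x : M}
    (hx : Function.Surjective (evalOne η x)) {v : TangentSpace 𝓘(ℝ, E) x} (hv : v ∈ ker₁ η x) :
    ∃ Z : VField E M, Z x = v ∧ (∀ᶠ z in 𝓝 x, ContMDiffAt 𝓘(ℝ, E) 𝓘(ℝ, E).tangent ∞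
      (fun z => (⟨z, Z z⟩ : TangentBundle 𝓘(ℝ, E) M)) z) ∧ ∀ᶠ z in 𝓝 x, Z z ∈ ker₁ η z := by
  have := isManifold_one E M
  have : CompleteSpace E := FiniteDimensional.complete ℝ E
  have : FiniteDimensional ℝ (TangentSpace 𝓘(ℝ, E) x) := inferInstanceAs (FiniteDimensional ℝ E)
  have : FiniteDimensional ℝ F := Module.Finite.of_surjective (evalOne η x) hx
  have : CompleteSpace F := FiniteDimensional.complete ℝ F
  set φ := extChartAt 𝓘(ℝ, E) x
  let L (y : E) : E →L[ℝ] F := oneFormCLM E F (inChart η x y)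
  have hL : ∀ᶠ y in 𝓝 (φ x), ContDiffAt ℝ ∞ L y :=
    ((isOpen_extChartAt_target x).eventually_mem (mem_extChartAt_target x)).mono fun y hy =>
      (oneFormCLM E F).contDiff.contDiffAt.comp y (hη.contDiffAt x hy)
  have hLx (w : E) : L (φ x) w = evalOne η x w :=
    (oneFormCLM_apply _ w).trans (inChart_self η x ![w])
  obtain ⟨S, hS⟩ := (L (φ x)).exists_rightInverse_of_surjective <|
    LinearMap.range_eq_top.2 fun c => (hx c).imp fun w hw => (hLx w).trans hw
  obtain ⟨V, hVx, hVs, hVL⟩ := exists_contDiffAt_mem_ker hL hS ((hLx v).trans hv)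
  have hφ : Tendsto φ (𝓝 x) (𝓝 (φ x)) := continuousAt_extChartAt x
  have hsource := extChartAt_source_mem_nhds (I := 𝓘(ℝ, E)) x
  refine ⟨mpullback 𝓘(ℝ, E) 𝓘(ℝ, E) φ V, ?_, ?_, ?_⟩
  · exact (congrArg (fun A : E →L[ℝ] E => A (V (φ x)))
      (inverse_mfderiv_extChartAt_self x)).trans hVx
  · filter_upwards [hsource, hφ.eventually hVs] with z hz hVz
    exact ContMDiffAt.mpullback_vectorField_preimage (n := ∞)
      (contMDiffAt_vectorSpace_iff_contDiffAt.2 hVz) (contMDiffAt_extChartAt' (by simpa using hz))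
      (isInvertible_mfderiv_extChartAt hz) le_rfl
  · filter_upwards [hsource, hφ.eventually hVL] with z hz hVz
    exact (oneForm_mpullback_extChartAt η x hz V).trans ((oneFormCLM_apply _ _).symm.trans hVz)

theorem exists_smoothVF_mem_ker₁ [T2Space M] {η : DForm E M F 1} (hη : SmoothForm η) {x : M}
    (hx : Function.Surjective (evalOne η x)) {v : TangentSpace 𝓘(ℝ, E) x} (hv : v ∈ ker₁ η x) :
    ∃ Y : VField E M, SmoothVF Y ∧ (∀ z, Y z ∈ ker₁ η z) ∧ Y x = v := by
  obtain ⟨Z, rfl, hZ, hZk⟩ := exists_contMDiffAt_mem_ker₁ hη hx hv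
  exact exists_smoothVF_of_eventually hZ hZk

end Extension

section Contact

variable {E : Type*} [NormedAddCommGroup E] [NormedSpace ℝ E]
variable {M : Type*} [TopologicalSpace M] [ChartedSpace E M]
variable {k : ℕ} {η : DForm E M (Fin k → ℝ) 1}

theorem IsKContactForm.evalOne_surjective (hη : IsKContactForm η) (x : M) :
    Function.Surjective (evalOne η x) :=
  LinearMap.range_eq_top.1 <| Submodule.eq_top_of_finrank_eq <|
    (evalOne η x).quotKerEquivRange.finrank_eq.symm.trans <|
      (hη.corank_ker x).trans (Module.finrank_fin_fun ℝ).symm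

variable [FiniteDimensional ℝ E]

theorem IsKContactForm.codisjoint_ker₁_span_reeb (hη : IsKContactForm η) (x : M) :
    Codisjoint (ker₁ η x) (Submodule.span ℝ (range fun α => reeb η α x)) := by
  rw [Submodule.codisjoint_iff_exists_add_eq]
  intro w
  set u := ∑ α, evalOne η x w α • reeb η α x
  have hu : evalOne η x u = evalOne η x w := by
    have hreeb (α : Fin k) : evalOne η x (reeb η α x) = Pi.single α 1 :=
      (isReebVector_reeb hη α x).1
    simp only [u, map_sum, map_smul, hreeb]
    exact (pi_eq_sum_univ' (evalOne η x w)).symm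
  refine ⟨w - u, u, ?_, ?_, sub_add_cancel w u⟩
  · change evalOne η x (w - u) = 0
    rw [map_sub, hu, sub_self]
  · exact Submodule.sum_mem _ fun α _ =>
      Submodule.smul_mem _ _ (Submodule.subset_span (mem_range_self α))

theorem IsKContactForm.linearMap_ext {G : Type*} [AddCommGroup G] [Module ℝ G]
    (hη : IsKContactForm η) {x : M} {A B : TangentSpace 𝓘(ℝ, E) x →ₗ[ℝ] G}
    (hker : ∀ v ∈ ker₁ η x, A v = B v) (hreeb : ∀ α, A (reeb η α x) = B (reeb η α x)) : A = B :=
  LinearMap.ext_on_codisjoint (hη.codisjoint_ker₁_span_reeb x) hker <|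
    LinearMap.eqOn_span (by rintro _ ⟨α, rfl⟩; exact hreeb α)

theorem IsKContactForm.extD_apply_reeb (hη : IsKContactForm η) {x : M}
    (v : TangentSpace 𝓘(ℝ, E) x) (α : Fin k) : extD η x ![v, reeb η α x] = 0 := by
  rw [twoForm_swap, (isReebVector_reeb hη α x).2, neg_zero]

theorem IsKContactForm.eq_of_eval (hη : IsKContactForm η) {x : M} {v w : TangentSpace 𝓘(ℝ, E) x}
    (h₁ : η x ![v] = η x ![w])
    (h₂ : ∀ u ∈ ker₁ η x, extD η x ![v, u] = extD η x ![w, u]) : v = w := by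
  have hext : evalTwo (extD η) x v = evalTwo (extD η) x w := by
    refine hη.linearMap_ext (fun u hu => ?_) fun α => ?_
    · rw [evalTwo_apply, evalTwo_apply, h₂ u hu]
    · rw [evalTwo_apply, evalTwo_apply, hη.extD_apply_reeb, hη.extD_apply_reeb]
  have hmem : v - w ∈ ker₁ η x ⊓ ker₂ (extD η) x := by
    refine ⟨(map_sub (evalOne η x) v w).trans (sub_eq_zero.2 h₁), fun u => ?_⟩
    have hu := LinearMap.congr_fun hext u
    rw [evalTwo_apply, evalTwo_apply, twoForm_swap, twoForm_swap _ x w, neg_inj] at hu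
    rw [twoForm_swap, ← evalTwo_apply, map_sub, evalTwo_apply, evalTwo_apply, hu, sub_self,
      neg_zero]
  rw [hη.ker_inf_ker x] at hmem
  exact sub_eq_zero.1 hmem

end Contact

section Hamiltonian

variable {E : Type*} [NormedAddCommGroup E] [NormedSpace ℝ E]
variable {M : Type*} [TopologicalSpace M] [ChartedSpace E M] [IsManifold 𝓘(ℝ, E) ∞ M]
variable {k : ℕ} {η : DForm E M (Fin k → ℝ) 1} {X Y : VField E M} {f g : M → (Fin k → ℝ)}

theorem IsEtaHamiltonianPair.eq_neg_contract (h : IsEtaHamiltonianPair η X f) :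
    f = -contract η X := funext h.2

theorem isEtaHamiltonianPair_etaHamVF (hf : IsEtaHamiltonianKFun η f) :
    IsEtaHamiltonianPair η (etaHamVF η f) f :=
  Classical.epsilon_spec (p := fun X => IsEtaHamiltonianPair η X f) hf

section LieAlgebra

variable [CompleteSpace E]

theorem IsEtaHamiltonianPair.contMDiff (h : IsEtaHamiltonianPair η X f) (hη : SmoothForm η) :
    ContMDiff 𝓘(ℝ, E) 𝓘(ℝ, Fin k → ℝ) ∞ f := by
  rw [h.eq_neg_contract]
  exact (contMDiff_contract hη h.1.1).neg

/-- The space of `η`-Hamiltonian vector fields. -/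
def etaHamiltonianFields (η : DForm E M (Fin k → ℝ) 1) : Submodule ℝ (VField E M) where
  carrier := {X | IsEtaHamiltonianVF η X}
  add_mem' {X Y} hX hY := by
    refine ⟨(smoothFields E M).add_mem hX.1 hY.1, fun Z hZ hZk x => ?_⟩
    rw [SmoothVF.mlieBracket_add_left hX.1 hY.1]
    exact (ker₁ η x).add_mem (hX.2 Z hZ hZk x) (hY.2 Z hZ hZk x)
  zero_mem' := by
    refine ⟨(smoothFields E M).zero_mem, fun Z _ _ x => ?_⟩
    rw [mlieBracket_zero_left]
    exact (ker₁ η x).zero_mem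
  smul_mem' c X hX := by
    refine ⟨(smoothFields E M).smul_mem c hX.1, fun Z hZ hZk x => ?_⟩
    rw [SmoothVF.mlieBracket_smul_left hX.1]
    exact (ker₁ η x).smul_mem c (hX.2 Z hZ hZk x)

protected theorem IsEtaHamiltonianVF.mlieBracket (hX : IsEtaHamiltonianVF η X)
    (hY : IsEtaHamiltonianVF η Y) : IsEtaHamiltonianVF η (mlieBracket 𝓘(ℝ, E) X Y) := by
  refine ⟨hX.1.mlieBracket hY.1, fun Z hZ hZk x => ?_⟩
  have hXYZ := hX.2 _ (hY.1.mlieBracket hZ) (hY.2 Z hZ hZk) x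
  have hYXZ := hY.2 _ (hX.1.mlieBracket hZ) (hX.2 Z hZ hZk) x
  rw [hX.1.leibniz_mlieBracket hY.1 hZ] at hXYZ
  exact ((ker₁ η x).add_mem_iff_left hYXZ).1 hXYZ

theorem isLieAlgebra_etaHamiltonianFields (η : DForm E M (Fin k → ℝ) 1) :
    IsLieAlgebra (etaHamiltonianFields η) fun X Y => mlieBracket 𝓘(ℝ, E) Y X :=
  isLieAlgebra_smoothFields.mono (fun _ hX => hX.1) fun _ hX _ hY =>
    IsEtaHamiltonianVF.mlieBracket hY hX

end LieAlgebra

variable [FiniteDimensional ℝ E] [T2Space M]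

theorem IsEtaHamiltonianPair.extD_apply_of_mem_ker₁ (h : IsEtaHamiltonianPair η X f)
    (hη : IsKContactForm η) {x : M} {v : TangentSpace 𝓘(ℝ, E) x} (hv : v ∈ ker₁ η x) :
    extD η x ![X x, v] = mvfderiv 𝓘(ℝ, E) f x v := by
  have : CompleteSpace E := FiniteDimensional.complete ℝ E
  obtain ⟨Y, hYs, hYk, rfl⟩ := exists_smoothVF_mem_ker₁ hη.smooth (hη.evalOne_surjective x) hv
  have hY : contract η Y = fun _ => 0 := funext hYk
  have hXY : contract η (mlieBracket 𝓘(ℝ, E) X Y) x = 0 := h.1.2 Y hYs hYk x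
  rw [extD_apply_vectorField hη.smooth h.1.1 hYs, hY, hXY, h.eq_neg_contract, mvfderiv_neg,
    mvfderiv_const]
  simp

theorem IsEtaHamiltonianPair.unique (hX : IsEtaHamiltonianPair η X f)
    (hY : IsEtaHamiltonianPair η Y f) (hη : IsKContactForm η) : X = Y :=
  funext fun x => hη.eq_of_eval (neg_injective ((hX.2 x).symm.trans (hY.2 x))) fun _ hu =>
    (hX.extD_apply_of_mem_ker₁ hη hu).trans (hY.extD_apply_of_mem_ker₁ hη hu).symm

theorem etaBracket_eq_contract_mlieBracket (hη : IsKContactForm η)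
    (hX : IsEtaHamiltonianPair η X f) (hY : IsEtaHamiltonianPair η Y g) :
    etaBracket η f g = contract η (mlieBracket 𝓘(ℝ, E) X Y) := by
  have hXf : etaHamVF η f = X := (isEtaHamiltonianPair_etaHamVF ⟨X, hX⟩).unique hX hη
  have hYg : etaHamVF η g = Y := (isEtaHamiltonianPair_etaHamVF ⟨Y, hY⟩).unique hY hη
  funext x
  rw [etaBracket, hXf, hYg, contract_apply]

theorem isLieAlgebra_etaBracket (hη : IsKContactForm η) {W : Submodule ℝ (M → (Fin k → ℝ))}
    (hH : ∀ f ∈ W, IsEtaHamiltonianKFun η f)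
    (hcl : ∀ f ∈ W, ∀ g ∈ W, etaBracket η f g ∈ W) : IsLieAlgebra W (etaBracket η) := by
  have : CompleteSpace E := FiniteDimensional.complete ℝ E
  refine ((isLieAlgebra_etaHamiltonianFields η).map (-contract η) (br' := etaBracket η)
    fun X hX Y hY => ?_).mono (fun f hf => ?_) hcl
  · refine (etaBracket_eq_contract_mlieBracket hη ⟨hX, fun _ => rfl⟩ ⟨hY, fun _ => rfl⟩).trans ?_
    rw [mlieBracket_swap, LinearMap.neg_apply, map_neg]
  · obtain ⟨X, hX⟩ := hH f hf
    exact ⟨X, hX.1, hX.eq_neg_contract.symm⟩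

theorem IsEtaHamiltonianPair.extD_apply (h : IsEtaHamiltonianPair η X f) (hη : IsKContactForm η)
    (hf : ReebInvariant η f) (x : M) (v : TangentSpace 𝓘(ℝ, E) x) :
    extD η x ![X x, v] = mvfderiv 𝓘(ℝ, E) f x v := by
  have hext : evalTwo (extD η) x (X x) = (mvfderiv 𝓘(ℝ, E) f x : _ →ₗ[ℝ] (Fin k → ℝ)) :=
    hη.linearMap_ext (fun v hv => (evalTwo_apply ..).trans (h.extD_apply_of_mem_ker₁ hη hv))
      fun α => (evalTwo_apply ..).trans ((hη.extD_apply_reeb _ α).trans (hf α x).symm)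
  exact (evalTwo_apply ..).symm.trans (LinearMap.congr_fun hext v)

theorem etaBracket_apply (hη : IsKContactForm η) (hX : IsEtaHamiltonianPair η X f)
    (hY : IsEtaHamiltonianPair η Y g) (hf : ReebInvariant η f) (hg : ReebInvariant η g) (x : M) :
    etaBracket η f g x = extD η x ![X x, Y x] := by
  have : CompleteSpace E := FiniteDimensional.complete ℝ E
  have hneg {Z : VField E M} {u : M → (Fin k → ℝ)} (hZ : IsEtaHamiltonianPair η Z u)
      (v : TangentSpace 𝓘(ℝ, E) x) :
      mvfderiv 𝓘(ℝ, E) (contract η Z) x v = -mvfderiv 𝓘(ℝ, E) u x v := by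
    rw [hZ.eq_neg_contract, mvfderiv_neg, neg_apply, neg_neg]
  -- The invariant formula reads `dη(X, Y) = -dη(Y, X) + dη(X, Y) - η([X, Y])`.
  have h := extD_apply_vectorField hη.smooth hX.1.1 hY.1.1 x
  rw [hneg hX, hneg hY, ← hX.extD_apply hη hf, ← hY.extD_apply hη hg, twoForm_swap _ x (Y x),
    neg_neg, sub_neg_eq_add, eq_sub_iff_add_eq] at h
  rw [etaBracket_eq_contract_mlieBracket hη hX hY]
  exact add_left_cancel h

end Hamiltonian

section Poisson

variable {E : Type*} [NormedAddCommGroup E] [NormedSpace ℝ E]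
variable {M : Type*} [TopologicalSpace M] [ChartedSpace E M]

/-- The map `f ↦ ⟨f, θ⟩` on vector-valued functions, the analogue of `pairForm` in degree zero. -/
def pairFun {F : Type*} [NormedAddCommGroup F] [NormedSpace ℝ F] (θ : F →L[ℝ] ℝ) :
    (M → F) →ₗ[ℝ] (M → ℝ) :=
  (θ : F →ₗ[ℝ] ℝ).compLeft M

theorem isConstantOfMotion_of_mfderiv_eq_zero {X : ℝ → VField E M} {C : M → ℝ}
    (hC : MDifferentiable 𝓘(ℝ, E) 𝓘(ℝ, ℝ) C)
    (h : ∀ t x, mfderiv 𝓘(ℝ, E) 𝓘(ℝ, ℝ) C x (X t x) = 0) : IsConstantOfMotion X C := by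
  intro J γ hJ hγ s hs t ht
  have hderiv (u : ℝ) (hu : u ∈ J) : HasDerivWithinAt (C ∘ γ) 0 J u := by
    have hchain := ((hC (γ u)).hasMFDerivAt.comp_hasMFDerivWithinAt u
      (hγ u hu)).hasFDerivWithinAt
    have hone := congrArg (mfderiv 𝓘(ℝ, E) 𝓘(ℝ, ℝ) C (γ u)) (one_smul ℝ (X u (γ u)))
    exact hasDerivWithinAt_iff_hasFDerivWithinAt.2 <| hchain.congr_fderiv <|
      ContinuousLinearMap.ext_ring <| (hone.trans (h u (γ u))).trans (one_smul ℝ (0 : ℝ)).symm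
  have hconst := hJ.convex.norm_image_sub_le_of_norm_hasDerivWithin_le hderiv
    (fun _ _ => norm_zero.le) hs ht
  rw [zero_mul, norm_le_zero_iff, sub_eq_zero] at hconst
  exact hconst.symm

variable [IsManifold 𝓘(ℝ, E) ∞ M]

theorem isPresymplectic_pairForm_extD {F : Type*} [NormedAddCommGroup F] [NormedSpace ℝ F]
    {η : DForm E M F 1} (hη : SmoothForm η) (θ : F →L[ℝ] ℝ) :
    IsPresymplectic (pairForm (extD η) θ) := by
  rw [← extD_pairForm hη]
  exact ⟨(hη.pairForm θ).extD, extD_extD (hη.pairForm θ)⟩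

variable [FiniteDimensional ℝ E] [T2Space M]
variable {k : ℕ} {η : DForm E M (Fin k → ℝ) 1} {X : VField E M} {f g : M → (Fin k → ℝ)}

theorem IsEtaHamiltonianPair.isHamiltonianVector (h : IsEtaHamiltonianPair η X f)
    (hη : IsKContactForm η) (hf : ReebInvariant η f) (θ : (Fin k → ℝ) →L[ℝ] ℝ) (x : M) :
    IsHamiltonianVector (pairForm (extD η) θ) (pairFun θ f) x (X x) := by
  have : CompleteSpace E := FiniteDimensional.complete ℝ E
  intro w
  have hchain : mfderiv 𝓘(ℝ, E) 𝓘(ℝ, ℝ) (θ ∘ f) x = _ := mfderiv_comp x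
    θ.mdifferentiableAt ((h.contMDiff hη.smooth x).mdifferentiableAt (by simp))
  rw [ContinuousLinearMap.mfderiv_eq] at hchain
  exact (congrArg θ (h.extD_apply hη hf x w)).trans
    (congrArg (fun L : E →L[ℝ] ℝ => L w) hchain).symm

theorem IsEtaHamiltonianPair.isHamiltonianFunction (h : IsEtaHamiltonianPair η X f)
    (hη : IsKContactForm η) (hf : ReebInvariant η f) (θ : (Fin k → ℝ) →L[ℝ] ℝ) :
    IsHamiltonianFunction (pairForm (extD η) θ) (pairFun θ f) := by
  have : CompleteSpace E := FiniteDimensional.complete ℝ E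
  exact ⟨θ.contDiff.contMDiff.comp (h.contMDiff hη.smooth), X, h.1.1,
    h.isHamiltonianVector hη hf θ⟩

theorem poissonBracket_pairFun (hη : IsKContactForm η) (θ : (Fin k → ℝ) →L[ℝ] ℝ)
    (hf : IsEtaHamiltonianKFun η f) (hg : IsEtaHamiltonianKFun η g) (hf' : ReebInvariant η f)
    (hg' : ReebInvariant η g) :
    poissonBracket (pairForm (extD η) θ) (pairFun θ f) (pairFun θ g) =
      pairFun θ (etaBracket η f g) := by
  obtain ⟨X, hX⟩ := hf
  obtain ⟨Y, hY⟩ := hg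
  funext x
  rw [poissonBracket_eq _ (hX.isHamiltonianVector hη hf' θ x)
    (hY.isHamiltonianVector hη hg' θ x)]
  exact congrArg θ (etaBracket_apply hη hX hY hf' hg' x).symm

theorem IsEtaHamiltonianPair.mfderiv_apply_eq_poissonBracket (h : IsEtaHamiltonianPair η X f)
    (hη : IsKContactForm η) (hf : ReebInvariant η f) {θ : (Fin k → ℝ) →L[ℝ] ℝ} {C : M → ℝ}
    (hC : IsAdmissible (pairForm (extD η) θ) C) (x : M) :
    mfderiv 𝓘(ℝ, E) 𝓘(ℝ, ℝ) C x (X x) =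
      poissonBracket (pairForm (extD η) θ) C (pairFun θ f) x := by
  obtain ⟨v, hv⟩ := hC.2 x
  rw [poissonBracket_eq _ hv (h.isHamiltonianVector hη hf θ x), hv]

variable {W : Submodule ℝ (M → (Fin k → ℝ))}

theorem mfderiv_apply_eq_zero_of_admitsLieHamiltonAlgebra (hη : IsKContactForm η)
    (hR : ∀ f ∈ W, ReebInvariant η f) {θ : (Fin k → ℝ) →L[ℝ] ℝ} {C : M → ℝ}
    (hC : IsAdmissible (pairForm (extD η) θ) C)
    (hCW : ∀ g ∈ W.map (pairFun θ), poissonBracket (pairForm (extD η) θ) C g = 0)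
    {X : ℝ → VField E M} (hX : AdmitsLieHamiltonAlgebra η W X) (t : ℝ) (x : M) :
    mfderiv 𝓘(ℝ, E) 𝓘(ℝ, ℝ) C x (X t x) = 0 := by
  obtain ⟨f, hf, hXf⟩ := hX t
  exact (hXf.mfderiv_apply_eq_poissonBracket hη (hR f hf) hC x).trans
    (congrFun (hCW _ (Submodule.mem_map_of_mem hf)) x)

end Poisson

end KContact

end

open KContact in
theorem mainTheorem4_general
    {E : Type*} [NormedAddCommGroup E] [NormedSpace ℝ E] [FiniteDimensional ℝ E]
    {M : Type*} [TopologicalSpace M] [T2Space M] [ChartedSpace E M] [IsManifold 𝓘(ℝ, E) ∞ M]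
    {k : ℕ} (η : DForm E M (Fin k → ℝ) 1) (hη : IsKContactForm η)
    (θ : (Fin k → ℝ) →L[ℝ] ℝ)
    (Ω : DForm E M ℝ 2) (hΩ : Ω = pairForm (extD η) θ) :
    IsPresymplectic Ω ∧
    ∀ (W : Submodule ℝ (M → (Fin k → ℝ))) (Wθ : Submodule ℝ (M → ℝ)),
      Wθ = W.map (pairFun θ) →
      (∀ f ∈ W, IsEtaHamiltonianKFun η f) →
      (∀ f ∈ W, ∀ g ∈ W, etaBracket η f g ∈ W) →
      (∀ f ∈ W, ReebInvariant η f) →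
      (∀ g ∈ Wθ, IsHamiltonianFunction Ω g) ∧
      (∃ (hW : IsLieAlgebra W (etaBracket η)) (hWθ : IsLieAlgebra Wθ (poissonBracket Ω)),
        letI := hW.lieRing
        letI := hW.lieAlgebra
        letI := hWθ.lieRing
        letI := hWθ.lieAlgebra
        ∃ φ : W →ₗ⁅ℝ⁆ Wθ, (∀ (f : W) (x : M), (φ f : M → ℝ) x = θ ((f : M → (Fin k → ℝ)) x)) ∧
          Function.Surjective φ) ∧
      (∀ C : M → ℝ, IsAdmissible Ω C → (∀ g ∈ Wθ, poissonBracket Ω C g = 0) →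
        ∀ X : ℝ → VField E M, AdmitsLieHamiltonAlgebra η W X →
          IsConstantOfMotion X C ∧
            ∀ t x, mfderiv 𝓘(ℝ, E) 𝓘(ℝ, ℝ) C x (X t x) = 0) := by
  subst hΩ
  refine ⟨isPresymplectic_pairForm_extD hη.smooth θ, ?_⟩
  rintro W _ rfl hH hcl hR
  have hW : IsLieAlgebra W (etaBracket η) := isLieAlgebra_etaBracket hη hH hcl
  have hbr (f) (hf : f ∈ W) (g) (hg : g ∈ W) :=
    poissonBracket_pairFun hη θ (hH f hf) (hH g hg) (hR f hf) (hR g hg)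
  refine ⟨?_, ⟨hW, hW.map _ hbr, ?_⟩, fun C hC hCW X hX => ?_⟩
  · rintro _ ⟨f, hf, rfl⟩
    exact (isEtaHamiltonianPair_etaHamVF (hH f hf)).isHamiltonianFunction hη (hR f hf) θ
  · obtain ⟨φ, hφ, hsurj⟩ := hW.exists_surjective_lieHom _ (hW.map _ hbr) hbr
    exact ⟨φ, fun f => congrFun (hφ f), hsurj⟩
  · have hXC := mfderiv_apply_eq_zero_of_admitsLieHamiltonAlgebra hη hR hC hCW hX
    exact ⟨isConstantOfMotion_of_mfderiv_eq_zero (hC.1.mdifferentiable (by simp)) hXC, hXC⟩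

open KContact in
theorem mainTheorem4
    {E : Type*} [NormedAddCommGroup E] [NormedSpace ℝ E] [FiniteDimensional ℝ E]
    {M : Type*} [TopologicalSpace M] [T2Space M] [ChartedSpace E M] [IsManifold 𝓘(ℝ, E) ∞ M]
    {k : ℕ} (η : DForm E M (Fin k → ℝ) 1) (hη : IsKContactForm η)
    (θ : (Fin k → ℝ) →L[ℝ] ℝ)
    (Ω : DForm E M ℝ 2) (hΩ : Ω = pairForm (extD η) θ) :
    IsPresymplectic Ω ∧
    ∀ (r : ℕ) (h : Fin r → M → (Fin k → ℝ))
      (W : Submodule ℝ (M → (Fin k → ℝ))) (Wθ : Submodule ℝ (M → ℝ)),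
      W = Submodule.span ℝ (Set.range h) →
      Wθ = Submodule.span ℝ (Set.range fun i x => θ (h i x)) →
      (∀ f ∈ W, IsEtaHamiltonianKFun η f) →
      (∀ f ∈ W, ∀ g ∈ W, etaBracket η f g ∈ W) →
      (∀ f ∈ W, ReebInvariant η f) →
      (∀ g ∈ Wθ, IsHamiltonianFunction Ω g) ∧
      (∃ (hW : IsLieAlgebra W (etaBracket η)) (hWθ : IsLieAlgebra Wθ (poissonBracket Ω)),
        letI := hW.lieRing
        letI := hW.lieAlgebra
        letI := hWθ.lieRing
        letI := hWθ.lieAlgebra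
        ∃ φ : W →ₗ⁅ℝ⁆ Wθ, (∀ (f : W) (x : M), (φ f : M → ℝ) x = θ ((f : M → (Fin k → ℝ)) x)) ∧
          Function.Surjective φ) ∧
      (∀ C : M → ℝ, IsAdmissible Ω C → (∀ g ∈ Wθ, poissonBracket Ω C g = 0) →
        ∀ X : ℝ → VField E M, AdmitsLieHamiltonAlgebra η W X →
          IsConstantOfMotion X C ∧
            ∀ t x, mfderiv 𝓘(ℝ, E) 𝓘(ℝ, ℝ) C x (X t x) = 0) := by
  obtain ⟨hpre, hgeneral⟩ := mainTheorem4_general η hη θ Ω hΩ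
  refine ⟨hpre, fun r h W Wθ hW hWθ => hgeneral W Wθ ?_⟩
  rw [hWθ, hW, Submodule.map_span, ← Set.range_comp]
  rfl
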